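/- Let $X_0, X_1, X_2, \dots$ be independent random points, uniformly distributed in the closed unit disk of $\mathbb{R}^2$, and let $R_j = \|X_j\|$ be the distance of node $j$ from the base station at the origin. For a network of $N$ nodes at distances $r = (r_j)$ with $0 < r_j \le 1$, and for transmission probabilities $p = (p_j) \in [0,1]^N$, the expected age of information of node $i$ in the capture model with roll-off $\beta$ and threshold $\theta$ is $$h_i(p, r) = \frac{1}{p_i \prod_{j \ne i} \left(1 - \frac{p_j}{1 + d_{ij}}\right)} \in [1, \infty], \qquad d_{ij} = \frac{r_j^{\beta}}{r_i^{\beta} \theta}.$$ Let $\beta = 2$ and $\theta = 1$. The proportionally fair policy $p^{PF}(r)$ is the minimizer of $\sum_i \log h_i(p, r)$ over $p \in [0,1]^N$; it exists and is unique. Fix a node $i$. For $N > i$ let $Z_i = Z_i^{(N)} = 1/p_i^{PF}(R_0, \dots, R_{N-1})$ in the network of the nodes $0, \dots, N-1$. For $0 < r_i \le 1$, the conditional law of $Z_i^{(N)}$ given $R_i = r_i$ is the law of the variable obtained by replacing $R_i$ by the constant $r_i$ and leaving the other $R_j$ as they are (for almost every $r_i$ this is the regular conditional distribution, and it is taken as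 the version of it for every $r_i \in (0,1]$). Put $$\mu_i = 1 - r_i^2 \log\left(1 + \frac{1}{r_i^2}\right), \qquad \sigma_i^2 = 1 - \frac{1}{1 + r_i^2} - \left(r_i^2 \log\left(1 + \frac{1}{r_i^2}\right)\right)^2 .$$ Then for every $r_i \in (0, 1]$ one has $\sigma_i^2 > 0$ and, conditionally on $R_i = r_i$: 1. for every $N > i$, $Z_i^{(N)} \ge 1$ almost surely, and $Z_i^{(N)}$ has an atom at $1$, of mass $\mathbb{P}[Z_i^{(N)} = 1] = \mathbb{P}\big[\sum_{j < N,\, j \ne i} R_j^2 \le r_i^2\big] > 0$; 2. $\dfrac{Z_i^{(N)} - N \mu_i}{\sqrt{N \sigma_i^2}}$ converges in distribution to the standard normal law as $N \to \infty$; 3. the Kolmogorov distance (the supremum distance of the distribution functions) between the law of $Z_i^{(N)}$ and the normal law $\mathcal{N}(N \mu_i, N \sigma_i^2)$ truncated to $[1, \infty)$, with the remaining mass $\mathcal{N}(N \mu_i, N \sigma_i^2)\big((-\infty, 1)\big)$ placed as an atom at $1$, tends to $0$ as $N \to \infty$. -/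

import Mathlib

open MeasureTheory ProbabilityTheory Filter Topology
open scoped ENNReal NNReal

noncomputable section

/-- The interference parameter `d i j = r_j ^ β / (r_i ^ β θ)` of a network whose node `k` is at
distance `r k` from the base station. -/
def interferenceRatio {ι : Type*} (β θ : ℝ) (r : ι → ℝ) (i j : ι) : ℝ :=
  r j ^ β / (r i ^ β * θ)

/-- The success probability `τ_i = p_i ∏_{j ≠ i} (1 - p_j / (1 + d i j))` of node `i` in a slot. -/
def successProb {ι : Type*} [Fintype ι] [DecidableEq ι] (β θ : ℝ) (r p : ι → ℝ) (i : ι) : ℝ :=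
  p i * ∏ j ∈ Finset.univ.erase i, (1 - p j / (1 + interferenceRatio β θ r i j))

/-- The time average expected age of information `h_i = 1 / τ_i` of node `i`. It is infinite when
the node never succeeds. -/
def expectedAoI {ι : Type*} [Fintype ι] [DecidableEq ι] (β θ : ℝ) (r p : ι → ℝ) (i : ι) : ℝ≥0∞ :=
  (ENNReal.ofReal (successProb β θ r p i))⁻¹

/-- The proportionally fair objective `∑ i, log h_i`, with value `⊤` if some `h_i` is infinite. -/
def pfObjective {ι : Type*} [Fintype ι] [DecidableEq ι] (β θ : ℝ) (r p : ι → ℝ) : EReal :=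
  ∑ i, ENNReal.log (expectedAoI β θ r p i)

/-- The transmission probability vectors. -/
def policyBox (ι : Type*) : Set (ι → ℝ) :=
  {p | ∀ i, 0 ≤ p i ∧ p i ≤ 1}

/-- `p` minimizes the proportionally fair objective among all transmission probability vectors. -/
def IsPFOptimal {ι : Type*} [Fintype ι] [DecidableEq ι] (β θ : ℝ) (r p : ι → ℝ) : Prop :=
  p ∈ policyBox ι ∧ IsMinOn (pfObjective β θ r) (policyBox ι) p

open Classical in
/-- The proportionally fair policy: the minimizer of the proportionally fair objective. The
alternative is a placeholder for position vectors without a minimizer. -/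
def pfPolicy {ι : Type*} [Fintype ι] [DecidableEq ι] (β θ : ℝ) (r : ι → ℝ) : ι → ℝ :=
  if h : ∃ p, IsPFOptimal β θ r p then h.choose else fun _ => 1

/-- `Z_i = 1 / p_i`, for the proportionally fair policy `p` of the network of the `N` nodes
`0, …, N - 1`, at distances `r 0, …, r (N - 1)`. It is meant for `i < N`; otherwise node `i` is not
in the network, and the value is a placeholder. -/
def pfInverse (β θ : ℝ) (N : ℕ) (r : ℕ → ℝ) (i : ℕ) : ℝ :=
  if h : i < N then 1 / pfPolicy β θ (fun j : Fin N => r j) ⟨i, h⟩ else 1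

/-- `μ(r) = 1 - r² log (1 + 1 / r²)`. -/
def pfMean (r : ℝ) : ℝ :=
  1 - r ^ 2 * Real.log (1 + 1 / r ^ 2)

/-- `σ²(r) = 1 - 1 / (1 + r²) - (r² log (1 + 1 / r²))²`. -/
def pfVar (r : ℝ) : ℝ :=
  1 - 1 / (1 + r ^ 2) - (r ^ 2 * Real.log (1 + 1 / r ^ 2)) ^ 2

/-- The normal law with mean `m` and variance `v` on `[1, ∞)`, its remaining mass being an atom
at `1`. -/
def spikedNormal (m : ℝ) (v : ℝ≥0) : Measure ℝ :=
  (gaussianReal m v).restrict (Set.Ici 1) + gaussianReal m v (Set.Iio 1) • Measure.dirac 1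

/-- The Kolmogorov distance, i.e. the uniform distance of the distribution functions. -/
def kolmogorovDist (μ ν : Measure ℝ) : ℝ :=
  ⨆ x : ℝ, |μ.real (Set.Iic x) - ν.real (Set.Iic x)|

/-- The distances of the nodes from the base station, which is at the origin, when the nodes are
at `X 0 ω, X 1 ω, …`. -/
def nodeDist {Ω : Type*} (X : ℕ → Ω → EuclideanSpace ℝ (Fin 2)) (ω : Ω) (j : ℕ) : ℝ :=
  ‖X j ω‖

/-- `Z_i` in the network of the first `N` nodes with roll-off `β = 2` and threshold `θ = 1`. -/
def pfZ {Ω : Type*} (X : ℕ → Ω → EuclideanSpace ℝ (Fin 2)) (i N : ℕ) (ω : Ω) : ℝ :=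
  pfInverse 2 1 N (nodeDist X ω) i

/-- `Z_i` in the same network when the distance of node `i` is fixed to be `r`, while the other
nodes stay random. -/
def pfZGiven {Ω : Type*} (X : ℕ → Ω → EuclideanSpace ℝ (Fin 2)) (i : ℕ) (r : ℝ) (N : ℕ)
    (ω : Ω) : ℝ :=
  pfInverse 2 1 N (Function.update (nodeDist X ω) i r) i

end

noncomputable section

/-! Taking logarithms turns the objective into a double sum. Regrouped by transmitting node, it
splits into one strictly concave problem in each `p_j`, so the policy exists, is unique, and is
found coordinate by coordinate (`isPFOptimal_iff_eq`). With `c = r_j²` and `u_k = r_k²`, the optimal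
`q = p_j` solves `∑ q u_k / (c + (1 - q) u_k) = 1`, or equals `1` when the left side is still at
most `1` there. The latter case is `∑ u_k ≤ c`, which gives the atom.

Let `S = ∑ u_k / (c + u_k)`. The first order condition forces `S ≤ 1/q ≤ S + 1/c`
(`IsPFRoot.sum_le_one_div`, `IsPFRoot.one_div_le_sum_add`), so `Z_i` is a sum of independent
identically distributed bounded terms up to an error that does not grow with `N`. A uniform point of
the disk has squared norm uniform on `[0, 1]`; integrating `u / (c + u)` and its square gives
`pfMean` and `pfVar`. The classical central limit theorem then applies, and the bounded error
vanishes after division by `√N`.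

For the Kolmogorov distance, Pólya's theorem makes the convergence of distribution functions
uniform. Below `1` both distribution functions vanish, and from `1` on the spiked law has the
distribution function of the normal law. -/

/-- The load `∑ k, q u_k / (c + (1 - q) u_k)`: the logarithmic derivative of the throughput product
in the transmission probability of a node at squared distance `c` is `(1 - pfLoad) / q`. -/
def pfLoad {κ : Type*} (s : Finset κ) (c : ℝ) (u : κ → ℝ) (q : ℝ) : ℝ :=
  ∑ k ∈ s, q * u k / (c + (1 - q) * u k)

/-- The part of the negated proportionally fair objective that depends on the transmission
probability `p` of a node at squared distance `c`. -/
def pfLogGain {κ : Type*} (s : Finset κ) (c : ℝ) (u : κ → ℝ) (p : ℝ) : ℝ :=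
  Real.log p + ∑ k ∈ s, Real.log (1 - p * (u k / (c + u k)))

/-- The first order condition for the maximizer of `pfLogGain` on `(0, 1]`. -/
structure IsPFRoot {κ : Type*} (s : Finset κ) (c : ℝ) (u : κ → ℝ) (q : ℝ) : Prop where
  pos : 0 < q
  le_one : q ≤ 1
  load_le : pfLoad s c u q ≤ 1
  eq_one_or : q = 1 ∨ pfLoad s c u q = 1

/-! ### The first order condition for a single node -/

section Root

variable {κ : Type*} {s : Finset κ} {c : ℝ} {u : κ → ℝ} {q t : ℝ}

theorem pfLoad_den_pos {v : ℝ} (hc : 0 < c) (hv : 0 ≤ v) (hq : q ≤ 1) :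
    0 < c + (1 - q) * v :=
  add_pos_of_pos_of_nonneg hc (mul_nonneg (sub_nonneg.2 hq) hv)

theorem pfLoad_one (s : Finset κ) (c : ℝ) (u : κ → ℝ) :
    pfLoad s c u 1 = (∑ k ∈ s, u k) / c := by
  simp [pfLoad, Finset.sum_div]

/-- The ratio `pfLoad / q` is nondecreasing, since the denominators shrink as `q` grows. So the load
grows at least linearly, which gives uniqueness of the root without differentiation. -/
theorem pfLoad_div_mul_le (hc : 0 < c) (hu : ∀ k ∈ s, 0 ≤ u k) (hq : 0 < q) (hqt : q ≤ t)
    (ht : t ≤ 1) : t / q * pfLoad s c u q ≤ pfLoad s c u t := by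
  rw [pfLoad, pfLoad, Finset.mul_sum]
  refine Finset.sum_le_sum fun k hk => ?_
  have h0 := hu k hk
  have hd := pfLoad_den_pos hc h0 ht
  have : t / q * (q * u k / (c + (1 - q) * u k)) = t * u k / (c + (1 - q) * u k) := by
    field_simp
  rw [this]
  have ht0 : 0 ≤ t * u k := mul_nonneg (hq.le.trans hqt) h0
  gcongr

theorem pfLoad_mono (hc : 0 < c) (hu : ∀ k ∈ s, 0 ≤ u k) (hq : 0 < q) (hqt : q ≤ t)
    (ht : t ≤ 1) : pfLoad s c u q ≤ pfLoad s c u t := by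
  refine le_trans ?_ (pfLoad_div_mul_le hc hu hq hqt ht)
  refine le_mul_of_one_le_left (Finset.sum_nonneg fun k hk => ?_) ((one_le_div hq).2 hqt)
  exact div_nonneg (mul_nonneg hq.le (hu k hk))
    (pfLoad_den_pos hc (hu k hk) (hqt.trans ht)).le

theorem exists_isPFRoot (hc : 0 < c) (hu : ∀ k ∈ s, 0 ≤ u k) : ∃ q, IsPFRoot s c u q := by
  rcases le_or_gt (pfLoad s c u 1) 1 with h | h
  · exact ⟨1, one_pos, le_rfl, h, Or.inl rfl⟩
  · have hcont : ContinuousOn (pfLoad s c u) (Set.Icc 0 1) := by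
      unfold pfLoad
      refine continuousOn_finsetSum _ fun k hk => ?_
      refine ContinuousOn.div (by fun_prop) (by fun_prop) fun x hx => ?_
      exact (pfLoad_den_pos hc (hu k hk) hx.2).ne'
    have h0 : pfLoad s c u 0 = 0 := by simp [pfLoad]
    obtain ⟨q, hq, hq1⟩ := intermediate_value_Icc zero_le_one hcont
      (show (1 : ℝ) ∈ Set.Icc (pfLoad s c u 0) (pfLoad s c u 1) from
        ⟨by rw [h0]; exact zero_le_one, h.le⟩)
    refine ⟨q, lt_of_le_of_ne hq.1 ?_, hq.2, hq1.le, Or.inr hq1⟩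
    rintro rfl
    exact zero_ne_one (h0.symm.trans hq1)

/-- Beyond a root `q < 1` the load is at least `t / q > 1`. This turns events about the implicitly
defined root into explicit inequalities, for the atom and for measurability. -/
theorem IsPFRoot.le_iff (h : IsPFRoot s c u q) (hc : 0 < c) (hu : ∀ k ∈ s, 0 ≤ u k)
    (ht0 : 0 < t) (ht : t ≤ 1) : t ≤ q ↔ pfLoad s c u t ≤ 1 := by
  refine ⟨fun htq => (pfLoad_mono hc hu ht0 htq h.le_one).trans h.load_le, fun hl => ?_⟩
  by_contra! hqt
  rcases h.eq_one_or with h1 | h1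
  · exact absurd (hqt.trans_le ht) (by simp [h1])
  · have := pfLoad_div_mul_le hc hu h.pos hqt.le ht
    rw [h1, mul_one] at this
    exact absurd ((one_lt_div h.pos).2 hqt) (not_lt.2 (this.trans hl))

theorem IsPFRoot.one_div_le_iff (h : IsPFRoot s c u q) (hc : 0 < c) (hu : ∀ k ∈ s, 0 ≤ u k)
    (ht : 1 ≤ t) : 1 / q ≤ t ↔ pfLoad s c u (1 / t) ≤ 1 := by
  have ht0 : 0 < t := one_pos.trans_le ht
  rw [one_div_le h.pos ht0, h.le_iff hc hu (by positivity) ((div_le_one ht0).2 ht)]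

theorem IsPFRoot.one_le_one_div (h : IsPFRoot s c u q) : 1 ≤ 1 / q :=
  (one_le_div h.pos).2 h.le_one

theorem IsPFRoot.one_div_eq_one_iff (h : IsPFRoot s c u q) (hc : 0 < c)
    (hu : ∀ k ∈ s, 0 ≤ u k) : 1 / q = 1 ↔ ∑ k ∈ s, u k ≤ c := by
  rw [← div_le_one hc, ← pfLoad_one]
  have := h.one_div_le_iff hc hu le_rfl
  rw [div_one] at this
  rw [← this]
  exact ⟨le_of_eq, fun h' => le_antisymm h' h.one_le_one_div⟩

/-- Enlarging each denominator `c + (1 - q) u` to `c + u` bounds `q S` by the load, hence by `1`. -/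
theorem IsPFRoot.sum_le_one_div (h : IsPFRoot s c u q) (hc : 0 < c) (hu : ∀ k ∈ s, 0 ≤ u k) :
    ∑ k ∈ s, u k / (c + u k) ≤ 1 / q := by
  rw [le_div_iff₀ h.pos, Finset.sum_mul]
  refine le_trans (Finset.sum_le_sum fun k hk => ?_) h.load_le
  have h0 := hu k hk
  have hq := h.pos
  rw [div_mul_eq_mul_div, mul_comm (u k)]
  have hd := pfLoad_den_pos hc h0 h.le_one
  have : (1 - q) * u k ≤ u k := by nlinarith
  gcongr

/-- At an interior root, `1 ≤ q (1 + q / c) S`; inserting `q S ≤ 1` in the second-order part gives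
`1 ≤ q S + q / c`. The error `1 / c` does not depend on the number of nodes. -/
theorem IsPFRoot.one_div_le_sum_add (h : IsPFRoot s c u q) (hc : 0 < c) (hc1 : c ≤ 1)
    (hu : ∀ k ∈ s, 0 ≤ u k) (hu1 : ∀ k ∈ s, u k ≤ 1) :
    1 / q ≤ ∑ k ∈ s, u k / (c + u k) + 1 / c := by
  have hS : 0 ≤ ∑ k ∈ s, u k / (c + u k) := Finset.sum_nonneg fun k hk => by
    have := hu k hk; positivity
  rcases h.eq_one_or with h1 | h1
  · rw [h1, div_one]
    exact le_add_of_nonneg_of_le hS ((one_le_div hc).2 hc1)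
  · have hq := h.pos
    have key : pfLoad s c u q ≤ q * (1 + q / c) * ∑ k ∈ s, u k / (c + u k) := by
      rw [pfLoad, Finset.mul_sum]
      refine Finset.sum_le_sum fun k hk => ?_
      have h0 := hu k hk
      have hk1 := hu1 k hk
      have hd := pfLoad_den_pos hc h0 h.le_one
      have hd' : 0 < c + u k := by positivity
      -- The difference of the two sides is `q (1 - u) + q (1 - q) u / c`; its sign uses `u ≤ 1`.
      have hb : c + u k ≤ (1 + q / c) * (c + (1 - q) * u k) := by
        have : (1 + q / c) * (c + (1 - q) * u k)
            = c + u k + q * (1 - u k) + q * (1 - q) * u k / c := by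
          field_simp; ring
        have h2 : 0 ≤ q * (1 - q) * u k / c := by
          have := sub_nonneg.2 h.le_one; positivity
        nlinarith [mul_nonneg hq.le (sub_nonneg.2 hk1)]
      rw [mul_div_assoc', div_le_div_iff₀ hd hd']
      have hqu : 0 ≤ q * u k := by positivity
      calc q * u k * (c + u k) ≤ q * u k * ((1 + q / c) * (c + (1 - q) * u k)) := by gcongr
        _ = _ := by ring
    rw [h1] at key
    have hS1 := h.sum_le_one_div hc hu
    set S := ∑ k ∈ s, u k / (c + u k)
    have hqS : q * S ≤ 1 := by rw [le_div_iff₀ hq] at hS1; linarith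
    rw [div_le_iff₀ hq]
    have : q * (1 + q / c) * S = q * S + q / c * (q * S) := by ring
    have h3 : q / c * (q * S) ≤ q / c := mul_le_of_le_one_right (by positivity) hqS
    have h4 : (S + 1 / c) * q = q * S + q / c := by ring
    linarith

theorem pfLogGain_arg_pos {v : ℝ} (hc : 0 < c) (hv : 0 ≤ v) (ht : t ≤ 1) :
    0 < 1 - t * (v / (c + v)) := by
  have hd : 0 < c + v := by positivity
  have : 1 - t * (v / (c + v)) = (c + (1 - t) * v) / (c + v) := by field_simp; ring
  rw [this]
  exact div_pos (pfLoad_den_pos hc hv ht) hd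

/-- Each logarithm lies below its tangent at `q`, strictly for `log p`. The first-order terms add up
to `(t - q) / q * (1 - pfLoad)`, which is nonpositive by the first order condition. -/
theorem IsPFRoot.pfLogGain_lt (h : IsPFRoot s c u q) (hc : 0 < c) (hu : ∀ k ∈ s, 0 ≤ u k)
    (ht0 : 0 < t) (ht : t ≤ 1) (hne : t ≠ q) : pfLogGain s c u t < pfLogGain s c u q := by
  have hq := h.pos
  have hlog : Real.log t - Real.log q < (t - q) / q := by
    rw [← Real.log_div ht0.ne' hq.ne', sub_div, div_self hq.ne']
    exact Real.log_lt_sub_one_of_pos (by positivity) (by rwa [Ne, div_eq_one_iff_eq hq.ne'])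
  have hsum : ∑ k ∈ s, Real.log (1 - t * (u k / (c + u k)))
      ≤ ∑ k ∈ s, Real.log (1 - q * (u k / (c + u k))) - (t - q) / q * pfLoad s c u q := by
    rw [pfLoad, Finset.mul_sum, ← Finset.sum_sub_distrib]
    refine Finset.sum_le_sum fun k hk => ?_
    have h0 := hu k hk
    have hpt := pfLogGain_arg_pos hc h0 ht
    have hpq := pfLogGain_arg_pos hc h0 h.le_one
    have hl := Real.log_le_sub_one_of_pos (div_pos hpt hpq)
    rw [Real.log_div hpt.ne' hpq.ne'] at hl
    have hd := pfLoad_den_pos hc h0 h.le_one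
    have hd' : 0 < c + u k := by positivity
    have e1 : 1 - q * (u k / (c + u k)) = (c + (1 - q) * u k) / (c + u k) := by
      field_simp; ring
    have e2 : 1 - t * (u k / (c + u k)) = (c + (1 - t) * u k) / (c + u k) := by
      field_simp; ring
    have : (1 - t * (u k / (c + u k))) / (1 - q * (u k / (c + u k))) - 1
        = -((t - q) / q * (q * u k / (c + (1 - q) * u k))) := by
      rw [e1, e2, div_div_div_cancel_right₀ hd'.ne', div_sub_one hd.ne', mul_div_assoc' _ _ _,
        ← mul_assoc, div_mul_cancel₀ _ hq.ne', ← neg_div]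
      ring
    linarith
  have hfin : (t - q) / q * (1 - pfLoad s c u q) ≤ 0 := by
    rcases h.eq_one_or with h1 | h1
    · exact mul_nonpos_of_nonpos_of_nonneg
        (div_nonpos_of_nonpos_of_nonneg (by linarith) hq.le) (sub_nonneg.2 h.load_le)
    · simp [h1]
  unfold pfLogGain
  nlinarith

end Root

/-! ### Decoupling the objective and identifying the policy -/

section Policy

theorem one_sub_div_interferenceRatio {ι : Type*} {r : ι → ℝ} (hr : ∀ j, 0 < r j) (x : ℝ) (i j : ι) :
    1 - x / (1 + interferenceRatio 2 1 r i j) = 1 - x * (r i ^ 2 / (r j ^ 2 + r i ^ 2)) := by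
  have hi := hr i
  have hj := hr j
  simp only [interferenceRatio, Real.rpow_two, mul_one]
  field_simp
  ring

variable {ι : Type*} [Fintype ι] [DecidableEq ι] {r p q : ι → ℝ}

theorem successProb_pos (hr : ∀ j, 0 < r j) (hp : ∀ j, p j ≤ 1) {i : ι} (hpi : 0 < p i) :
    0 < successProb 2 1 r p i := by
  refine mul_pos hpi (Finset.prod_pos fun j _ => ?_)
  rw [one_sub_div_interferenceRatio hr]
  exact pfLogGain_arg_pos (by have := hr j; positivity) (sq_nonneg _) (hp j)

theorem pfObjective_eq_top {β θ : ℝ} {i : ι} (hpi : p i = 0) : pfObjective β θ r p = ⊤ := by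
  have hi : ENNReal.log (expectedAoI β θ r p i) = ⊤ := by
    simp [expectedAoI, successProb, hpi]
  -- In `EReal` one has `⊤ + ⊥ = ⊥`, so the infinite term prevails only because no other term is
  -- `⊥`: the inverse of a finite `ENNReal` is not `0`.
  have hbot : ∀ t : Finset ι, ∑ j ∈ t, ENNReal.log (expectedAoI β θ r p j) ≠ ⊥ := by
    intro t
    induction t using Finset.induction_on with
    | empty => simp
    | insert a t ha ih =>
      rw [Finset.sum_insert ha, Ne, EReal.add_eq_bot_iff, not_or]
      refine ⟨?_, ih⟩
      simp [expectedAoI]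
  rw [pfObjective, ← Finset.add_sum_erase _ _ (Finset.mem_univ i), hi]
  exact EReal.top_add_of_ne_bot (hbot _)

/-- Exchanging the order of summation gathers, for each `j`, its own `log p_j` and its interference
with every other node, so no summand involves two transmission probabilities. -/
theorem pfObjective_eq_coe (hr : ∀ j, 0 < r j) (hp0 : ∀ j, 0 < p j) (hp : ∀ j, p j ≤ 1) :
    pfObjective 2 1 r p =
      ((-∑ j, pfLogGain (Finset.univ.erase j) (r j ^ 2) (fun k => r k ^ 2) (p j) : ℝ) : EReal) := by
  have hterm : ∀ i, ENNReal.log (expectedAoI 2 1 r p i)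
      = ((-Real.log (successProb 2 1 r p i) : ℝ) : EReal) := by
    intro i
    have hs := successProb_pos hr hp (hp0 i)
    rw [expectedAoI, ENNReal.log_inv, ENNReal.log_ofReal_of_pos hs, EReal.coe_neg]
  have hlog : ∀ i, Real.log (successProb 2 1 r p i) = Real.log (p i) +
      ∑ j ∈ Finset.univ.erase i, Real.log (1 - p j * (r i ^ 2 / (r j ^ 2 + r i ^ 2))) := by
    intro i
    have hne : ∀ j ∈ Finset.univ.erase i, 1 - p j / (1 + interferenceRatio 2 1 r i j) ≠ 0 := by
      intro j _
      rw [one_sub_div_interferenceRatio hr]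
      exact (pfLogGain_arg_pos (by have := hr j; positivity) (sq_nonneg _) (hp j)).ne'
    rw [successProb, Real.log_mul (hp0 i).ne' (Finset.prod_ne_zero_iff.2 hne), Real.log_prod hne]
    simp only [one_sub_div_interferenceRatio hr]
  rw [pfObjective]
  simp only [hterm, hlog]
  have hcoe : ∀ f : ι → ℝ, ∑ i, (f i : EReal) = ((∑ i, f i : ℝ) : EReal) := fun f =>
    (map_sum (⟨⟨Real.toEReal, EReal.coe_zero⟩, EReal.coe_add⟩ : ℝ →+ EReal) f _).symm
  rw [hcoe, Finset.sum_neg_distrib]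
  simp only [pfLogGain, Finset.sum_add_distrib]
  congr 3
  refine Finset.sum_comm' fun i j => ?_
  simp [ne_comm]

theorem isPFOptimal_iff_eq (hr : ∀ j, 0 < r j)
    (hq : ∀ j, IsPFRoot (Finset.univ.erase j) (r j ^ 2) (fun k => r k ^ 2) (q j)) :
    IsPFOptimal 2 1 r p ↔ p = q := by
  have hqbox : q ∈ policyBox ι := fun j => ⟨(hq j).pos.le, (hq j).le_one⟩
  have hval := pfObjective_eq_coe hr (fun j => (hq j).pos) fun j => (hq j).le_one
  have hlt : ∀ p ∈ policyBox ι, p ≠ q → pfObjective 2 1 r q < pfObjective 2 1 r p := by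
    intro p hp hne
    by_cases h0 : ∃ i, p i = 0
    · obtain ⟨i, hi⟩ := h0
      rw [pfObjective_eq_top hi, hval]
      exact EReal.coe_lt_top _
    · push Not at h0
      have hpos : ∀ i, 0 < p i := fun i => lt_of_le_of_ne (hp i).1 (h0 i).symm
      rw [hval, pfObjective_eq_coe hr hpos fun j => (hp j).2, EReal.coe_lt_coe_iff,
        neg_lt_neg_iff]
      have hgain : ∀ j, p j ≠ q j → pfLogGain (Finset.univ.erase j) (r j ^ 2) (fun k => r k ^ 2)
          (p j) < pfLogGain (Finset.univ.erase j) (r j ^ 2) (fun k => r k ^ 2) (q j) := fun j hj =>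
        (hq j).pfLogGain_lt (pow_pos (hr j) 2) (fun _ _ => sq_nonneg _) (hpos j) (hp j).2 hj
      obtain ⟨j, hj⟩ := Function.ne_iff.1 hne
      refine Finset.sum_lt_sum (fun j _ => ?_) ⟨j, Finset.mem_univ j, hgain j hj⟩
      by_cases h : p j = q j
      · rw [h]
      · exact (hgain j h).le
  constructor
  · rintro ⟨hp, hmin⟩
    by_contra hne
    exact absurd (hmin hqbox) (not_le.2 (hlt p hp hne))
  · rintro rfl
    refine ⟨hqbox, fun p' hp' => ?_⟩
    by_cases h : p' = p
    · simp [h]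
    · exact (hlt p' hp' h).le

theorem existsUnique_isPFOptimal (hr : ∀ j, 0 < r j) : ∃! p, IsPFOptimal 2 1 r p := by
  choose q hq using fun j => exists_isPFRoot (s := Finset.univ.erase j) (u := fun k => r k ^ 2)
    (pow_pos (hr j) 2) fun _ _ => sq_nonneg _
  exact ⟨q, (isPFOptimal_iff_eq hr hq).2 rfl, fun p hp => (isPFOptimal_iff_eq hr hq).1 hp⟩

theorem isPFRoot_pfPolicy (hr : ∀ j, 0 < r j) (j : ι) :
    IsPFRoot (Finset.univ.erase j) (r j ^ 2) (fun k => r k ^ 2) (pfPolicy 2 1 r j) := by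
  choose q hq using fun j => exists_isPFRoot (s := Finset.univ.erase j) (u := fun k => r k ^ 2)
    (pow_pos (hr j) 2) fun _ _ => sq_nonneg _
  have hex : ∃ p, IsPFOptimal 2 1 r p := (existsUnique_isPFOptimal hr).exists
  have : pfPolicy 2 1 r = q := by
    rw [pfPolicy, dif_pos hex]
    exact (isPFOptimal_iff_eq hr hq).1 hex.choose_spec
  rw [this]
  exact hq j

end Policy

theorem exists_pfInverse_eq {N i : ℕ} (hi : i < N) {r : ℕ → ℝ} (hr : ∀ j < N, 0 < r j) :
    ∃ q, pfInverse 2 1 N r i = 1 / q ∧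
      IsPFRoot ((Finset.range N).erase i) (r i ^ 2) (fun k => r k ^ 2) q := by
  have h := isPFRoot_pfPolicy (r := fun j : Fin N => r j) (fun j => hr j j.2) ⟨i, hi⟩
  have hmap : (Finset.range N).erase i
      = (Finset.univ.erase (⟨i, hi⟩ : Fin N)).map Fin.valEmbedding := by
    ext k
    simp only [Finset.mem_erase, Finset.mem_range, Finset.mem_map, Finset.mem_univ, and_true,
      Fin.valEmbedding_apply]
    constructor
    · rintro ⟨h1, h2⟩
      exact ⟨⟨k, h2⟩, by simpa [Fin.ext_iff] using h1, rfl⟩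
    · rintro ⟨a, h1, rfl⟩
      exact ⟨by simpa [Fin.ext_iff] using h1, a.2⟩
  have hload : ∀ q, pfLoad ((Finset.range N).erase i) (r i ^ 2) (fun k => r k ^ 2) q
      = pfLoad (Finset.univ.erase (⟨i, hi⟩ : Fin N)) (r i ^ 2) (fun k => r k ^ 2) q := by
    intro q
    rw [hmap, pfLoad, Finset.sum_map]
    rfl
  refine ⟨_, by rw [pfInverse, dif_pos hi], h.pos, h.le_one, ?_, ?_⟩
  · rw [hload]; exact h.load_le
  · rw [hload]; exact h.eq_one_or

/-! ### Moments of the summands for a uniform point of the disk -/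

section Uniform

variable {Ω : Type*} [MeasurableSpace Ω] {P : Measure Ω} {X : Ω → EuclideanSpace ℝ (Fin 2)}

/-- The squared norm of a uniform point of the unit disk is uniform on the unit interval. -/
theorem map_norm_sq_of_isUniform_closedBall (hX : Measurable X)
    (hu : pdf.IsUniform X (Metric.closedBall 0 1) P volume) :
    P.map (fun ω => ‖X ω‖ ^ 2) = (volume : Measure ℝ).restrict (Set.Ioc 0 1) := by
  have hns : (volume : Measure (EuclideanSpace ℝ (Fin 2))) (Metric.closedBall 0 1) ≠ 0 :=
    (Metric.measure_closedBall_pos _ _ one_pos).ne'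
  have hnt : (volume : Measure (EuclideanSpace ℝ (Fin 2))) (Metric.closedBall 0 1) ≠ ∞ :=
    measure_closedBall_lt_top.ne
  have := hu.isProbabilityMeasure hns hnt
  have hm : Measurable fun ω => ‖X ω‖ ^ 2 := by fun_prop
  have := Measure.isProbabilityMeasure_map (μ := P) hm.aemeasurable
  refine Measure.ext_of_Iic _ _ fun t => ?_
  rw [Measure.map_apply hm measurableSet_Iic, Measure.restrict_apply measurableSet_Iic]
  have hpre : (fun ω => ‖X ω‖ ^ 2) ⁻¹' Set.Iic t = X ⁻¹' {x | ‖x‖ ^ 2 ≤ t} := rfl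
  rw [hpre, hu.measure_preimage hns hnt (measurableSet_le (by fun_prop) (by fun_prop))]
  rcases lt_or_ge t 0 with ht | ht
  · have h1 : {x : EuclideanSpace ℝ (Fin 2) | ‖x‖ ^ 2 ≤ t} = ∅ := by
      ext x
      simp only [Set.mem_ofPred_eq, Set.mem_empty_iff_false, iff_false, not_le]
      exact ht.trans_le (sq_nonneg _)
    have h2 : Set.Iic t ∩ Set.Ioc (0 : ℝ) 1 = ∅ := by
      ext x
      simp only [Set.mem_inter_iff, Set.mem_Iic, Set.mem_Ioc, Set.mem_empty_iff_false, iff_false]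
      intro h
      linarith [h.1, h.2.1]
    simp [h1, h2]
  · have hm0 : 0 ≤ min 1 t := le_min zero_le_one ht
    -- The area of a disk is proportional to its squared radius; the minimum with `1` covers `t >
    -- 1`.
    have h1 : Metric.closedBall 0 1 ∩ {x : EuclideanSpace ℝ (Fin 2) | ‖x‖ ^ 2 ≤ t}
        = Metric.closedBall 0 (√(min 1 t)) := by
      ext x
      simp only [Set.mem_inter_iff, mem_closedBall_zero_iff, Set.mem_ofPred_eq]
      rw [Real.le_sqrt (norm_nonneg _) hm0, le_min_iff, sq_le_one_iff₀ (norm_nonneg _)]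
    have h2 : Set.Iic t ∩ Set.Ioc (0 : ℝ) 1 = Set.Ioc 0 (min 1 t) := by
      ext x
      simp only [Set.mem_inter_iff, Set.mem_Iic, Set.mem_Ioc, le_min_iff]
      tauto
    rw [h1, h2, Measure.addHaar_closedBall' _ _ (Real.sqrt_nonneg _), Real.volume_Ioc,
      finrank_euclideanSpace_fin, Real.sq_sqrt hm0, sub_zero, mul_div_assoc,
      ENNReal.div_self hns hnt, mul_one]

theorem ae_norm_mem_Ioc_of_isUniform_closedBall (hX : Measurable X)
    (hu : pdf.IsUniform X (Metric.closedBall 0 1) P volume) :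
    ∀ᵐ ω ∂P, 0 < ‖X ω‖ ∧ ‖X ω‖ ≤ 1 := by
  have hm : Measurable fun ω => ‖X ω‖ ^ 2 := by fun_prop
  have h : ∀ᵐ u ∂(P.map fun ω => ‖X ω‖ ^ 2), u ∈ Set.Ioc (0 : ℝ) 1 := by
    rw [map_norm_sq_of_isUniform_closedBall hX hu]
    exact ae_restrict_mem measurableSet_Ioc
  filter_upwards [ae_of_ae_map hm.aemeasurable h] with ω hω
  refine ⟨?_, (sq_le_one_iff₀ (norm_nonneg _)).1 hω.2⟩
  exact lt_of_le_of_ne (norm_nonneg _) fun h0 => by simp [← h0] at hω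

theorem measure_norm_sq_le_pos (hX : Measurable X)
    (hu : pdf.IsUniform X (Metric.closedBall 0 1) P volume) {t : ℝ} (ht : 0 < t) :
    0 < P {ω | ‖X ω‖ ^ 2 ≤ t} := by
  have hm : Measurable fun ω => ‖X ω‖ ^ 2 := by fun_prop
  have : P {ω | ‖X ω‖ ^ 2 ≤ t} = P.map (fun ω => ‖X ω‖ ^ 2) (Set.Iic t) :=
    (Measure.map_apply hm measurableSet_Iic).symm
  rw [this, map_norm_sq_of_isUniform_closedBall hX hu, Measure.restrict_apply measurableSet_Iic]
  refine lt_of_lt_of_le ?_ (measure_mono (show Set.Ioc 0 (min 1 t) ⊆ _ from fun x hx =>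
    ⟨hx.2.trans (min_le_right _ _), hx.1, hx.2.trans (min_le_left _ _)⟩))
  simp [ht]

theorem integral_div_const_add {c : ℝ} (hc : 0 < c) :
    ∫ u in (0 : ℝ)..1, u / (c + u) = 1 - c * Real.log (1 + 1 / c) := by
  have hpos : ∀ u ∈ Set.uIcc (0 : ℝ) 1, c + u ≠ 0 := fun u hu => by
    rw [Set.uIcc_of_le zero_le_one] at hu
    linarith [hu.1]
  rw [intervalIntegral.integral_eq_sub_of_hasDerivAt
    (f := fun u => u - c * Real.log (c + u))]
  · have : 1 + 1 / c = (c + 1) / c := by field_simp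
    rw [this, Real.log_div (by positivity) hc.ne']
    simp only [add_zero]
    ring
  · intro u hu
    have h := (hasDerivAt_id u).sub
      ((((hasDerivAt_id u).const_add c).log (hpos u hu)).const_mul c)
    refine h.congr_deriv ?_
    have := hpos u hu
    simp only [id]
    field_simp
    ring
  · refine ContinuousOn.intervalIntegrable ?_
    exact ContinuousOn.div (by fun_prop) (by fun_prop) hpos

theorem integral_sq_div_const_add {c : ℝ} (hc : 0 < c) :
    ∫ u in (0 : ℝ)..1, (u / (c + u)) ^ 2
      = 1 - 2 * c * Real.log (1 + 1 / c) + c / (c + 1) := by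
  have hpos : ∀ u ∈ Set.uIcc (0 : ℝ) 1, c + u ≠ 0 := fun u hu => by
    rw [Set.uIcc_of_le zero_le_one] at hu
    linarith [hu.1]
  rw [intervalIntegral.integral_eq_sub_of_hasDerivAt
    (f := fun u => u - 2 * c * Real.log (c + u) - c ^ 2 * (c + u)⁻¹)]
  · have : 1 + 1 / c = (c + 1) / c := by field_simp
    rw [this, Real.log_div (by positivity) hc.ne']
    simp only [add_zero]
    field_simp
    ring
  · intro u hu
    have h := ((hasDerivAt_id u).sub
      ((((hasDerivAt_id u).const_add c).log (hpos u hu)).const_mul (2 * c))).sub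
      ((((hasDerivAt_id u).const_add c).inv (hpos u hu)).const_mul (c ^ 2))
    refine h.congr_deriv ?_
    have := hpos u hu
    simp only [id]
    field_simp
    ring
  · refine ContinuousOn.intervalIntegrable ?_
    exact (ContinuousOn.div (by fun_prop) (by fun_prop) hpos).pow 2

theorem integral_comp_norm_sq (hX : Measurable X)
    (hu : pdf.IsUniform X (Metric.closedBall 0 1) P volume) {f : ℝ → ℝ} (hf : Measurable f) :
    ∫ ω, f (‖X ω‖ ^ 2) ∂P = ∫ u in (0 : ℝ)..1, f u := by
  have hm : Measurable fun ω => ‖X ω‖ ^ 2 := by fun_prop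
  rw [intervalIntegral.integral_of_le zero_le_one, ← map_norm_sq_of_isUniform_closedBall hX hu,
    integral_map hm.aemeasurable hf.aestronglyMeasurable]

theorem integral_norm_sq_div (hX : Measurable X)
    (hu : pdf.IsUniform X (Metric.closedBall 0 1) P volume) {r : ℝ} (hr : 0 < r) :
    ∫ ω, ‖X ω‖ ^ 2 / (r ^ 2 + ‖X ω‖ ^ 2) ∂P = pfMean r := by
  rw [integral_comp_norm_sq hX hu (f := fun u => u / (r ^ 2 + u)) (by fun_prop),
    integral_div_const_add (by positivity), pfMean]

theorem norm_sq_div_mem_Icc (x : EuclideanSpace ℝ (Fin 2)) {r : ℝ} (hr : 0 < r) :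
    ‖x‖ ^ 2 / (r ^ 2 + ‖x‖ ^ 2) ∈ Set.Icc (0 : ℝ) 1 := by
  refine ⟨by positivity, (div_le_one (by positivity)).2 ?_⟩
  nlinarith [sq_nonneg r]

theorem memLp_norm_sq_div [IsFiniteMeasure P] (hX : Measurable X) {r : ℝ} (hr : 0 < r) :
    MemLp (fun ω => ‖X ω‖ ^ 2 / (r ^ 2 + ‖X ω‖ ^ 2)) 2 P := by
  refine MemLp.of_bound (Measurable.aestronglyMeasurable (by fun_prop)) 1 (ae_of_all _ fun ω => ?_)
  have h := norm_sq_div_mem_Icc (X ω) hr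
  rw [Real.norm_of_nonneg h.1]
  exact h.2

theorem variance_norm_sq_div [IsProbabilityMeasure P] (hX : Measurable X)
    (hu : pdf.IsUniform X (Metric.closedBall 0 1) P volume) {r : ℝ} (hr : 0 < r) :
    Var[fun ω => ‖X ω‖ ^ 2 / (r ^ 2 + ‖X ω‖ ^ 2); P] = pfVar r := by
  rw [variance_eq_sub (memLp_norm_sq_div hX hr), integral_norm_sq_div hX hu hr]
  simp only [Pi.pow_apply]
  rw [integral_comp_norm_sq hX hu (f := fun u => (u / (r ^ 2 + u)) ^ 2) (by fun_prop),
    integral_sq_div_const_add (by positivity), pfMean, pfVar]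
  field_simp
  ring

end Uniform

/-- With `c = r²` and `L = log (1 + 1/c)`, positivity amounts to `L² < 1 / (c (c + 1))`. The right
side is `(2 sinh (L/2))²`, so `x < sinh x` suffices. -/
theorem pfVar_pos {r : ℝ} (hr : 0 < r) : 0 < pfVar r := by
  set c := r ^ 2 with hc
  have hc0 : 0 < c := by positivity
  set L := Real.log (1 + 1 / c) with hL
  have hL0 : 0 < L := Real.log_pos (by have : 0 < 1 / c := by positivity
                                       linarith)
  have hs : L / 2 < Real.sinh (L / 2) := Real.self_lt_sinh_iff.2 (by positivity)
  have hexp : Real.exp L = 1 + 1 / c := Real.exp_log (by positivity)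
  have hsq : (2 * Real.sinh (L / 2)) ^ 2 = 1 / (c * (c + 1)) := by
    rw [Real.sinh_eq]
    have e1 : Real.exp (L / 2) ^ 2 = 1 + 1 / c := by
      rw [← hexp, ← Real.exp_nat_mul]; congr 1; push_cast; ring
    have e2 : Real.exp (-(L / 2)) ^ 2 = (1 + 1 / c)⁻¹ := by
      rw [Real.exp_neg, inv_pow, e1]
    have e3 : Real.exp (L / 2) * Real.exp (-(L / 2)) = 1 := by
      rw [← Real.exp_add]; simp
    have : (2 * ((Real.exp (L / 2) - Real.exp (-(L / 2))) / 2)) ^ 2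
        = Real.exp (L / 2) ^ 2 + Real.exp (-(L / 2)) ^ 2
          - 2 * (Real.exp (L / 2) * Real.exp (-(L / 2))) := by ring
    rw [this, e1, e2, e3]
    field_simp
    ring
  have hlt : L ^ 2 < 1 / (c * (c + 1)) := by
    rw [← hsq]
    exact pow_lt_pow_left₀ (by linarith) hL0.le two_ne_zero
  have : (c * L) ^ 2 < c / (c + 1) := by
    calc (c * L) ^ 2 = c ^ 2 * L ^ 2 := by ring
      _ < c ^ 2 * (1 / (c * (c + 1))) := by gcongr
      _ = c / (c + 1) := by field_simp
  have h1 : 1 - 1 / (1 + c) = c / (c + 1) := by field_simp; ring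
  have : pfVar r = 1 - 1 / (1 + c) - (c * L) ^ 2 := rfl
  linarith

/-! ### Uniform convergence of distribution functions -/

section Polya

theorem continuous_cdf_of_noAtoms (ν : Measure ℝ) [IsProbabilityMeasure ν] (h : ∀ x, ν {x} = 0) :
    Continuous (cdf ν) := by
  refine continuous_iff_continuousAt.2 fun x => ?_
  rw [(monotone_cdf ν).continuousAt_iff_leftLim_eq_rightLim, (cdf ν).rightLim_eq]
  have hx := (cdf ν).measure_singleton x
  rw [measure_cdf, h x, eq_comm, ENNReal.ofReal_eq_zero] at hx
  exact le_antisymm ((monotone_cdf ν).leftLim_le le_rfl) (by linarith)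

/-- **Pólya's theorem**: pointwise convergence of distribution functions to a continuous one is
uniform. -/
theorem eventually_abs_cdf_sub_le {ν : Measure ℝ} [IsProbabilityMeasure ν]
    {F : ℕ → ℝ → ℝ} (hcont : Continuous (cdf ν)) (hF : ∀ n, Monotone (F n))
    (hF0 : ∀ n x, 0 ≤ F n x) (hF1 : ∀ n x, F n x ≤ 1)
    (hlim : ∀ x, Tendsto (fun n => F n x) atTop (𝓝 (cdf ν x))) {ε : ℝ} (hε : 0 < ε) :
    ∀ᶠ n in atTop, ∀ x, |F n x - cdf ν x| ≤ ε := by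
  obtain ⟨K, hK⟩ := exists_nat_gt (3 / ε)
  have hK0 : (0 : ℝ) < K := lt_trans (by positivity) hK
  have hKε : 3 / (K : ℝ) < ε := by
    rw [div_lt_iff₀ hε] at hK
    rw [div_lt_iff₀ hK0]
    linarith
  -- Continuity provides points where the limit takes each level `k / K`. Closeness at these
  -- finitely many points, together with monotonicity, controls every `x`.
  have hsurj : ∀ y ∈ Set.Ioo (0 : ℝ) 1, ∃ x, cdf ν x = y := fun y hy =>
    mem_range_of_exists_le_of_exists_ge hcont
      (((tendsto_cdf_atBot ν).eventually (eventually_lt_nhds hy.1)).exists.imp fun _ h => h.le)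
      (((tendsto_cdf_atTop ν).eventually (eventually_gt_nhds hy.2)).exists.imp fun _ h => h.le)
  have hgrid : ∀ k ∈ Finset.Ioo 0 K, ∃ x, cdf ν x = (k : ℝ) / K := fun k hk => by
    rw [Finset.mem_Ioo] at hk
    have h0 : (0 : ℝ) < k := by exact_mod_cast hk.1
    have h1 : (k : ℝ) < K := by exact_mod_cast hk.2
    exact hsurj _ ⟨by positivity, (div_lt_one hK0).2 h1⟩
  choose! g hg using hgrid
  have hev : ∀ᶠ n in atTop, ∀ k ∈ Finset.Ioo 0 K, |F n (g k) - cdf ν (g k)| < 1 / K := by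
    rw [Filter.eventually_all_finset]
    intro k _
    have := (Metric.tendsto_nhds.1 (hlim (g k))) (1 / K) (by positivity)
    simpa [Real.dist_eq] using this
  filter_upwards [hev] with n hn x
  have hc0 := cdf_nonneg ν x
  have hc1 := cdf_le_one ν x
  set k := ⌊(K : ℝ) * cdf ν x⌋₊ with hk
  have hk1 : (k : ℝ) ≤ K * cdf ν x := Nat.floor_le (by positivity)
  have hk2 : K * cdf ν x < k + 1 := Nat.lt_floor_add_one _
  have hsplit : (3 : ℝ) / K = 1 / K + 1 / K + 1 / K := by ring
  have hcl : (k : ℝ) / K ≤ cdf ν x := by rw [div_le_iff₀ hK0]; linarith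
  have hcu : cdf ν x < (k : ℝ) / K + 1 / K := by
    rw [← add_div, lt_div_iff₀ hK0]; linarith
  have hKpos : 0 < 1 / (K : ℝ) := by positivity
  have hup : F n x ≤ cdf ν x + 3 / K := by
    by_cases h : k + 1 < K
    · have hmem : k + 1 ∈ Finset.Ioo 0 K := Finset.mem_Ioo.2 ⟨k.succ_pos, h⟩
      have hgk := hg _ hmem
      push_cast at hgk
      rw [add_div] at hgk
      have hle : x ≤ g (k + 1) := by
        by_contra! hlt
        have := monotone_cdf ν hlt.le
        linarith
      have h1 := hF n hle
      have h2 := (abs_lt.1 (hn _ hmem)).2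
      linarith
    · have hKk : (K : ℝ) ≤ k + 1 := by exact_mod_cast not_lt.1 h
      have : 1 ≤ (k : ℝ) / K + 1 / K := by rw [← add_div, le_div_iff₀ hK0]; linarith
      linarith [hF1 n x]
  have hlow : cdf ν x - 3 / K ≤ F n x := by
    by_cases h : 1 < k
    · have hkK : k ≤ K := by
        have : (k : ℝ) ≤ K := hk1.trans (mul_le_of_le_one_right hK0.le hc1)
        exact_mod_cast this
      -- The level `k - 1` is used because `cdf ν x` may equal `k / K` on a flat stretch, where `g k
      -- ≤ x` can fail. This costs the third `1 / K`.
      have hmem : k - 1 ∈ Finset.Ioo 0 K := Finset.mem_Ioo.2 ⟨by omega, by omega⟩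
      have hgk := hg _ hmem
      rw [Nat.cast_sub h.le, Nat.cast_one, sub_div] at hgk
      have hle : g (k - 1) ≤ x := by
        by_contra! hlt
        have := monotone_cdf ν hlt.le
        linarith
      have h1 := hF n hle
      have h2 := (abs_lt.1 (hn _ hmem)).1
      linarith
    · have hk1' : (k : ℝ) ≤ 1 := by exact_mod_cast not_lt.1 h
      have : (k : ℝ) / K ≤ 1 / K := by gcongr
      linarith [hF0 n x]
  rw [abs_le]
  constructor <;> linarith

end Polya

/-! ### Measurability of the inverse policy -/

theorem pfInverse_congr {β θ : ℝ} {N i : ℕ} {r r' : ℕ → ℝ} (h : ∀ j < N, r j = r' j) :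
    pfInverse β θ N r i = pfInverse β θ N r' i := by
  have : (fun j : Fin N => r j) = fun j : Fin N => r' j := funext fun j => h j j.2
  simp only [pfInverse, this]

/-- The policy is defined by choice, so measurability is read off the sublevel sets: for positive
distances they are given by `pfLoad ≤ 1`, and elsewhere the function is set to `1`. -/
theorem exists_measurable_eq_pfInverse {N i : ℕ} (hi : i < N) :
    ∃ G : (ℕ → ℝ) → ℝ, Measurable G ∧
      ∀ r : ℕ → ℝ, (∀ j < N, 0 < r j) → G r = pfInverse 2 1 N r i := by
  classical
  set A : Set (ℕ → ℝ) := {r | ∀ j < N, 0 < r j} with hA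
  have hAm : MeasurableSet A := by
    have : A = ⋂ j ∈ Finset.range N, {r : ℕ → ℝ | 0 < r j} := by ext; simp [hA]
    rw [this]
    exact Finset.measurableSet_biInter _ fun j _ =>
      measurableSet_lt measurable_const (measurable_pi_apply j)
  refine ⟨A.piecewise (fun r => pfInverse 2 1 N r i) 1, ?_,
    fun r hr => Set.piecewise_eq_of_mem A _ _ hr⟩
  refine measurable_of_Iic fun t => ?_
  rcases lt_or_ge t 1 with ht | ht
  · convert MeasurableSet.empty
    refine Set.eq_empty_of_forall_notMem fun r hr => ?_
    rw [Set.mem_preimage, Set.mem_Iic] at hr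
    by_cases hrA : r ∈ A
    · obtain ⟨q, hq, hroot⟩ := exists_pfInverse_eq hi hrA
      rw [Set.piecewise_eq_of_mem _ _ _ hrA, hq] at hr
      linarith [hroot.one_le_one_div]
    · rw [Set.piecewise_eq_of_notMem _ _ _ hrA, Pi.one_apply] at hr
      linarith
  · have : A.piecewise (fun r => pfInverse 2 1 N r i) 1 ⁻¹' Set.Iic t = Aᶜ ∪ (A ∩
        {r | pfLoad ((Finset.range N).erase i) (r i ^ 2) (fun k => r k ^ 2) (1 / t) ≤ 1}) := by
      ext r
      rw [Set.mem_preimage, Set.mem_Iic]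
      by_cases hrA : r ∈ A
      · obtain ⟨q, hq, hroot⟩ := exists_pfInverse_eq hi hrA
        rw [Set.piecewise_eq_of_mem _ _ _ hrA, hq,
          hroot.one_div_le_iff (pow_pos (hrA i hi) 2) (fun _ _ => sq_nonneg _) ht]
        simp [hrA]
      · rw [Set.piecewise_eq_of_notMem _ _ _ hrA]
        simp [hrA, ht]
    rw [this]
    refine hAm.compl.union (hAm.inter (measurableSet_le ?_ measurable_const))
    unfold pfLoad
    fun_prop

/-! ### Conditioning on an independent variable -/

section CondDistrib

variable {Ω α β γ : Type*} [MeasurableSpace Ω] [MeasurableSpace α] [MeasurableSpace β]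
  [MeasurableSpace γ] [StandardBorelSpace γ] [Nonempty γ] {P : Measure Ω} [IsProbabilityMeasure P]

/-- The conditional law of `H (U, V)` given an independent `U = x` is the law of `H (x, V)`. -/
theorem condDistrib_comp_prodMk_of_indepFun {U : Ω → α} {V : Ω → β} {H : α × β → γ}
    (hU : Measurable U) (hV : Measurable V) (hH : Measurable H) (hind : IndepFun U V P) :
    ∀ᵐ x ∂(P.map U), condDistrib (fun ω => H (U ω, V ω)) U P x = P.map fun ω => H (x, V ω) := by
  -- The kernel `κ` freezes `x` and pushes the law of `V` through `H`; by independence it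
  -- disintegrates the joint law, which determines `condDistrib` almost everywhere.
  have := Measure.isProbabilityMeasure_map (μ := P) hV.aemeasurable
  have := Measure.isProbabilityMeasure_map (μ := P) hU.aemeasurable
  set κ : Kernel α γ := (Kernel.id ×ₖ Kernel.const α (P.map V)).map H with hκ
  have hκ_apply : ∀ x, κ x = (P.map V).map fun v => H (x, v) := by
    intro x
    rw [hκ, Kernel.map_apply _ hH, Kernel.prod_apply, Kernel.id_apply, Kernel.const_apply,
      Measure.dirac_prod, Measure.map_map hH (by fun_prop)]
    rfl
  have : IsMarkovKernel κ := Kernel.IsMarkovKernel.map _ hH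
  have hprod : P.map (fun ω => (U ω, H (U ω, V ω))) = P.map U ⊗ₘ κ := by
    have h1 : P.map (fun ω => (U ω, V ω)) = (P.map U).prod (P.map V) :=
      (indepFun_iff_map_prod_eq_prod_map_map hU.aemeasurable hV.aemeasurable).1 hind
    have h2 : P.map (fun ω => (U ω, H (U ω, V ω)))
        = ((P.map U).prod (P.map V)).map fun z => (z.1, H z) := by
      rw [← h1, Measure.map_map (by fun_prop) (by fun_prop)]
      rfl
    rw [h2]
    ext s hs
    have hz : Measurable fun z : α × β => (z.1, H z) := by fun_prop
    rw [Measure.map_apply hz hs, Measure.prod_apply (hz hs), Measure.compProd_apply hs]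
    refine lintegral_congr fun x => ?_
    rw [hκ_apply, Measure.map_apply (by fun_prop) (measurable_prodMk_left hs)]
    rfl
  filter_upwards [condDistrib_ae_eq_of_measure_eq_compProd U
    (by fun_prop : AEMeasurable (fun ω => H (U ω, V ω)) P) hprod] with x hx
  rw [hx, hκ_apply, Measure.map_map (by fun_prop) hV]
  rfl

end CondDistrib

/-! ### Root description of the network with a fixed distance -/

section SamplePath

variable {Ω : Type*} {X : ℕ → Ω → EuclideanSpace ℝ (Fin 2)} {i N : ℕ} {r : ℝ}

theorem update_nodeDist_pos {ω : Ω} (hr : 0 < r) (hω : ∀ j, 0 < nodeDist X ω j) (j : ℕ) :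
    0 < Function.update (nodeDist X ω) i r j := by
  rcases eq_or_ne j i with rfl | hj
  · simpa using hr
  · simpa [hj] using hω j

theorem exists_pfZGiven_eq {ω : Ω} (hi : i < N) (hr : 0 < r) (hω : ∀ j, 0 < nodeDist X ω j) :
    ∃ q, pfZGiven X i r N ω = 1 / q ∧
      IsPFRoot ((Finset.range N).erase i) (r ^ 2) (fun k => nodeDist X ω k ^ 2) q := by
  obtain ⟨q, hq, h⟩ := exists_pfInverse_eq hi fun j _ => update_nodeDist_pos (i := i) hr hω j
  have hload : pfLoad ((Finset.range N).erase i) (r ^ 2) (fun k => nodeDist X ω k ^ 2) q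
      = pfLoad ((Finset.range N).erase i) (Function.update (nodeDist X ω) i r i ^ 2)
        (fun k => Function.update (nodeDist X ω) i r k ^ 2) q := by
    unfold pfLoad
    refine Finset.sum_congr rfl fun k hk => ?_
    simp [Function.update_of_ne (Finset.ne_of_mem_erase hk)]
  refine ⟨q, hq, h.pos, h.le_one, ?_, ?_⟩
  · rw [hload]; exact h.load_le
  · rw [hload]; exact h.eq_one_or

end SamplePath

/-! ### Distribution functions of the normal and spiked normal laws -/

theorem gaussianReal_real_Iic {m v : ℝ} (hv : 0 < v) (x : ℝ) :
    (gaussianReal m v.toNNReal).real (Set.Iic x) = cdf (gaussianReal 0 1) ((x - m) / √v) := by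
  have hs : 0 < √v := Real.sqrt_pos.2 hv
  have h : gaussianReal m v.toNNReal = (gaussianReal 0 1).map fun z => m + √v * z := by
    have : (fun z : ℝ => m + √v * z) = (m + ·) ∘ (√v * ·) := rfl
    rw [this, ← Measure.map_map (by fun_prop) (by fun_prop), gaussianReal_map_const_mul,
      gaussianReal_map_const_add, mul_zero, zero_add, mul_one]
    congr 1
    ext
    simp [Real.sq_sqrt hv.le, hv.le]
  rw [h, map_measureReal_apply (by fun_prop) measurableSet_Iic, cdf_eq_real]
  congr 1
  ext z
  simp only [Set.mem_preimage, Set.mem_Iic]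
  rw [le_div_iff₀ hs]
  constructor <;> intro <;> linarith

theorem spikedNormal_real_Iic_of_lt (m : ℝ) (v : ℝ≥0) {x : ℝ} (hx : x < 1) :
    (spikedNormal m v).real (Set.Iic x) = 0 := by
  have h : Set.Iic x ∩ Set.Ici 1 = ∅ := by
    ext y
    simp only [Set.mem_inter_iff, Set.mem_Iic, Set.mem_Ici, Set.mem_empty_iff_false, iff_false]
    intro h
    linarith [h.1, h.2]
  simp [measureReal_def, spikedNormal, Measure.restrict_apply, h, hx]

theorem spikedNormal_real_Iic_of_le (m : ℝ) (v : ℝ≥0) {x : ℝ} (hx : 1 ≤ x) :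
    (spikedNormal m v).real (Set.Iic x) = (gaussianReal m v).real (Set.Iic x) := by
  have hU : Set.Iic x = (Set.Iic x ∩ Set.Ici 1) ∪ Set.Iio 1 := by
    ext y
    simp only [Set.mem_inter_iff, Set.mem_Iic, Set.mem_Ici, Set.mem_union, Set.mem_Iio]
    constructor
    · intro h
      rcases lt_or_ge y 1 with h1 | h1
      · exact Or.inr h1
      · exact Or.inl ⟨h, h1⟩
    · rintro (h | h)
      · exact h.1
      · linarith
  have hd : Disjoint (Set.Iic x ∩ Set.Ici 1) (Set.Iio 1) := by
    rw [Set.disjoint_left]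
    intro y hy hy'
    exact absurd (Set.mem_Iio.1 hy') (not_lt.2 hy.2)
  have h : gaussianReal m v (Set.Iic x)
      = gaussianReal m v (Set.Iic x ∩ Set.Ici 1) + gaussianReal m v (Set.Iio 1) := by
    conv_lhs => rw [hU]
    exact measure_union hd measurableSet_Iio
  rw [measureReal_def, measureReal_def, h]
  simp [spikedNormal, Measure.restrict_apply, hx]

/-! ### The random network: conditional law, atom and limit theorems -/

section Network

variable {Ω : Type*} [MeasurableSpace Ω] {P : Measure Ω}
  {X : ℕ → Ω → EuclideanSpace ℝ (Fin 2)} {i N : ℕ} {r : ℝ}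

theorem ae_nodeDist_mem_Ioc (hmeas : ∀ j, Measurable (X j))
    (hunif : ∀ j, pdf.IsUniform (X j) (Metric.closedBall 0 1) P volume) :
    ∀ᵐ ω ∂P, ∀ j, 0 < nodeDist X ω j ∧ nodeDist X ω j ≤ 1 :=
  ae_all_iff.2 fun j => ae_norm_mem_Ioc_of_isUniform_closedBall (hmeas j) (hunif j)

theorem measurable_nodeDist (hmeas : ∀ j, Measurable (X j)) : Measurable (nodeDist X) :=
  measurable_pi_lambda _ fun j => (hmeas j).norm

theorem aemeasurable_pfZGiven (hmeas : ∀ j, Measurable (X j))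
    (hunif : ∀ j, pdf.IsUniform (X j) (Metric.closedBall 0 1) P volume) (hr : 0 < r) :
    AEMeasurable (pfZGiven X i r N) P := by
  by_cases hi : i < N
  · obtain ⟨G, hG, hGeq⟩ := exists_measurable_eq_pfInverse hi
    refine ⟨fun ω => G (Function.update (nodeDist X ω) i r), hG.comp ?_, ?_⟩
    · refine measurable_pi_lambda _ fun j => ?_
      rcases eq_or_ne j i with rfl | hj
      · simp
      · simpa [hj, nodeDist] using (hmeas j).norm
    · filter_upwards [ae_nodeDist_mem_Ioc hmeas hunif] with ω hω
      exact (hGeq _ fun j _ => update_nodeDist_pos hr (fun j => (hω j).1) j).symm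
  · have : pfZGiven X i r N = fun _ => 1 := by
      ext ω
      simp [pfZGiven, pfInverse, hi]
    rw [this]
    exact aemeasurable_const

theorem aemeasurable_pfZ (hmeas : ∀ j, Measurable (X j))
    (hunif : ∀ j, pdf.IsUniform (X j) (Metric.closedBall 0 1) P volume) (hi : i < N) :
    AEMeasurable (pfZ X i N) P := by
  obtain ⟨G, hG, hGeq⟩ := exists_measurable_eq_pfInverse hi
  refine ⟨fun ω => G (nodeDist X ω), hG.comp (measurable_nodeDist hmeas), ?_⟩
  filter_upwards [ae_nodeDist_mem_Ioc hmeas hunif] with ω hω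
  exact (hGeq _ fun j _ => (hω j).1).symm

theorem condDistrib_pfZ [IsProbabilityMeasure P] (hmeas : ∀ j, Measurable (X j))
    (hindep : iIndepFun X P)
    (hunif : ∀ j, pdf.IsUniform (X j) (Metric.closedBall 0 1) P volume) (hi : i < N) :
    ∀ᵐ r ∂(P.map (fun ω => nodeDist X ω i)),
      condDistrib (pfZ X i N) (fun ω => nodeDist X ω i) P r = P.map (pfZGiven X i r N) := by
  classical
  obtain ⟨G, hG, hGeq⟩ := exists_measurable_eq_pfInverse hi
  set T := (Finset.range N).erase i with hT
  -- `e` rebuilds a configuration from the distance of node `i` and those of the other nodes below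
  -- `N`. The filler `1` is immaterial, since only indices below `N` matter.
  set e : ℝ × (T → ℝ) → ℕ → ℝ :=
    fun z j => if j = i then z.1 else if h : j ∈ T then z.2 ⟨j, h⟩ else 1 with he
  have hem : Measurable e := by
    refine measurable_pi_lambda _ fun j => ?_
    by_cases hj : j = i
    · simpa [he, hj] using measurable_fst
    · by_cases hjT : j ∈ T
      · simp only [he, hj, hjT, if_false, dif_pos]
        fun_prop
      · simp [he, hj, hjT]
  set U : Ω → ℝ := fun ω => nodeDist X ω i with hU
  set V : Ω → T → ℝ := fun ω j => nodeDist X ω j with hV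
  have hUm : Measurable U := (hmeas i).norm
  have hVm : Measurable V := measurable_pi_lambda _ fun j => (hmeas j).norm
  have hind : IndepFun U V P := by
    have h := (hindep.comp (fun _ x => ‖x‖) fun _ => measurable_norm).indepFun_finset {i} T
      (by simp [hT]) fun j => (hmeas j).norm
    exact h.comp (φ := fun v : ({i} : Finset ℕ) → ℝ => v ⟨i, Finset.mem_singleton_self i⟩)
      (ψ := id) (measurable_pi_apply _) measurable_id
  have heq : ∀ (x : ℝ) ω, ∀ j < N, e (x, V ω) j = Function.update (nodeDist X ω) i x j := by
    intro x ω j hj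
    rcases eq_or_ne j i with rfl | hji
    · simp [he]
    · have : j ∈ T := Finset.mem_erase.2 ⟨hji, Finset.mem_range.2 hj⟩
      simp [he, hji, this, hV]
  have hGe : ∀ x, 0 < x → ∀ᵐ ω ∂P, pfZGiven X i x N ω = G (e (x, V ω)) := by
    intro x hx
    filter_upwards [ae_nodeDist_mem_Ioc hmeas hunif] with ω hω
    rw [hGeq _ fun j hj => ?_]
    · exact (pfInverse_congr (heq x ω)).symm
    · rw [heq x ω j hj]
      exact update_nodeDist_pos hx (fun j => (hω j).1) j
  have hZ : pfZ X i N =ᵐ[P] fun ω => G (e (U ω, V ω)) := by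
    filter_upwards [ae_nodeDist_mem_Ioc hmeas hunif] with ω hω
    have h : ∀ j < N, e (U ω, V ω) j = nodeDist X ω j := fun j hj => by
      rw [heq _ ω j hj, hU, Function.update_eq_self]
    rw [hGeq _ fun j hj => by rw [h j hj]; exact (hω j).1]
    exact (pfInverse_congr h).symm
  have hpos : ∀ᵐ x ∂(P.map U), 0 < x := by
    rw [ae_map_iff hUm.aemeasurable measurableSet_Ioi]
    filter_upwards [ae_nodeDist_mem_Ioc hmeas hunif] with ω hω
    exact (hω i).1
  rw [condDistrib_congr_left hZ]
  filter_upwards [hpos, condDistrib_comp_prodMk_of_indepFun hUm hVm (hG.comp hem) hind]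
    with x hx hcond
  rw [Measure.map_congr (hGe x hx)]
  exact hcond

theorem ae_one_le_pfZGiven (hmeas : ∀ j, Measurable (X j))
    (hunif : ∀ j, pdf.IsUniform (X j) (Metric.closedBall 0 1) P volume) (hr : 0 < r)
    (hi : i < N) : ∀ᵐ ω ∂P, 1 ≤ pfZGiven X i r N ω := by
  filter_upwards [ae_nodeDist_mem_Ioc hmeas hunif] with ω hω
  obtain ⟨q, hq, h⟩ := exists_pfZGiven_eq hi hr fun j => (hω j).1
  rw [hq]
  exact h.one_le_one_div

theorem measure_pfZGiven_eq_one (hmeas : ∀ j, Measurable (X j))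
    (hunif : ∀ j, pdf.IsUniform (X j) (Metric.closedBall 0 1) P volume) (hr : 0 < r)
    (hi : i < N) : P {ω | pfZGiven X i r N ω = 1} =
      P {ω | ∑ j ∈ (Finset.range N).erase i, nodeDist X ω j ^ 2 ≤ r ^ 2} := by
  refine measure_congr (eventuallyEq_set.2 ?_)
  filter_upwards [ae_nodeDist_mem_Ioc hmeas hunif] with ω hω
  obtain ⟨q, hq, h⟩ := exists_pfZGiven_eq hi hr fun j => (hω j).1
  rw [hq]
  exact h.one_div_eq_one_iff (by positivity) fun _ _ => sq_nonneg _

theorem measure_sum_nodeDist_sq_le_pos (hmeas : ∀ j, Measurable (X j)) (hindep : iIndepFun X P)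
    (hunif : ∀ j, pdf.IsUniform (X j) (Metric.closedBall 0 1) P volume) (s : Finset ℕ)
    (hr : 0 < r) : 0 < P {ω | ∑ j ∈ s, nodeDist X ω j ^ 2 ≤ r ^ 2} := by
  -- If each of the independent `R_j²` is at most `t`, their sum is at most `r²`; the `+ 1` covers
  -- empty `s`.
  set t : ℝ := r ^ 2 / (s.card + 1) with ht
  have ht0 : 0 < t := by positivity
  have hsub : (⋂ j ∈ s, X j ⁻¹' {x | ‖x‖ ^ 2 ≤ t})
      ⊆ {ω | ∑ j ∈ s, nodeDist X ω j ^ 2 ≤ r ^ 2} := by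
    intro ω hω
    simp only [Set.mem_iInter, Set.mem_preimage, Set.mem_ofPred_eq] at hω
    calc ∑ j ∈ s, nodeDist X ω j ^ 2 ≤ s.card • t := Finset.sum_le_card_nsmul _ _ _ hω
      _ ≤ r ^ 2 := by
        rw [nsmul_eq_mul, ht, mul_div_assoc', div_le_iff₀ (by positivity)]
        nlinarith [sq_nonneg r]
  refine lt_of_lt_of_le ?_ (measure_mono hsub)
  rw [hindep.measure_inter_preimage_eq_mul s fun j _ =>
    measurableSet_le (by fun_prop) measurable_const]
  exact pos_iff_ne_zero.2 (Finset.prod_ne_zero_iff.2 fun j _ =>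
    (measure_norm_sq_le_pos (hmeas j) (hunif j) ht0).ne')

/-- The sum includes node `i` at its random position, so that it is a full sum of independent
identically distributed terms. The extra term lies in `[0, 1]`, whence the `+ 1`. -/
theorem ae_abs_pfZGiven_sub_le (hmeas : ∀ j, Measurable (X j))
    (hunif : ∀ j, pdf.IsUniform (X j) (Metric.closedBall 0 1) P volume) (hr : 0 < r)
    (hr1 : r ≤ 1) : ∀ᵐ ω ∂P, ∀ N, i < N →
      |pfZGiven X i r N ω - ∑ j ∈ Finset.range N, ‖X j ω‖ ^ 2 / (r ^ 2 + ‖X j ω‖ ^ 2)|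
        ≤ 1 / r ^ 2 + 1 := by
  filter_upwards [ae_nodeDist_mem_Ioc hmeas hunif] with ω hω N hi
  obtain ⟨q, hq, h⟩ := exists_pfZGiven_eq hi hr fun j => (hω j).1
  have hlow := h.sum_le_one_div (by positivity) fun _ _ => sq_nonneg _
  have hup := h.one_div_le_sum_add (by positivity) (pow_le_one₀ hr.le hr1)
    (fun _ _ => sq_nonneg _) fun k _ => pow_le_one₀ (hω k).1.le (hω k).2
  have hI := norm_sq_div_mem_Icc (X i ω) hr
  rw [hq, ← Finset.sum_erase_add _ _ (Finset.mem_range.2 hi)]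
  simp only [nodeDist] at hlow hup
  have hr0 : 0 < 1 / r ^ 2 := by positivity
  rw [abs_le]
  constructor <;> linarith [hI.1, hI.2]

theorem tendstoInDistribution_sum [IsProbabilityMeasure P] (hmeas : ∀ j, Measurable (X j))
    (hindep : iIndepFun X P)
    (hunif : ∀ j, pdf.IsUniform (X j) (Metric.closedBall 0 1) P volume) (hr : 0 < r) :
    TendstoInDistribution (fun (N : ℕ) ω =>
        (∑ j ∈ Finset.range N, ‖X j ω‖ ^ 2 / (r ^ 2 + ‖X j ω‖ ^ 2) - N * pfMean r)
          / √(N * pfVar r)) atTop (id : ℝ → ℝ) (fun _ => P) (gaussianReal 0 1) := by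
  have hv := pfVar_pos hr
  set Y : ℕ → Ω → ℝ := fun j ω => ‖X j ω‖ ^ 2 / (r ^ 2 + ‖X j ω‖ ^ 2) with hY
  have hmean : ∫ ω, Y 0 ω ∂P = pfMean r := integral_norm_sq_div (hmeas 0) (hunif 0) hr
  have hvar : Var[Y 0; P] = pfVar r := variance_norm_sq_div (hmeas 0) (hunif 0) hr
  have hf : Measurable fun x : EuclideanSpace ℝ (Fin 2) => ‖x‖ ^ 2 / (r ^ 2 + ‖x‖ ^ 2) := by
    fun_prop
  have hYind : iIndepFun Y P := hindep.comp (fun _ x => ‖x‖ ^ 2 / (r ^ 2 + ‖x‖ ^ 2)) fun _ => hf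
  have hYid : ∀ j, IdentDistrib (Y j) (Y 0) P P := fun j =>
    IdentDistrib.comp ⟨(hmeas j).aemeasurable, (hmeas 0).aemeasurable,
      (hunif j).trans (hunif 0).symm⟩ hf
  have hlaw : HasLaw (fun x : ℝ => √(pfVar r) * x) (gaussianReal 0 Var[Y 0; P].toNNReal)
      (gaussianReal 0 1) := by
    refine ⟨by fun_prop, ?_⟩
    rw [gaussianReal_map_const_mul, hvar, mul_zero, mul_one]
    congr 1
    ext
    simp [Real.sq_sqrt hv.le, hv.le]
  have h := (tendstoInDistribution_inv_sqrt_mul_sum_sub hlaw (memLp_norm_sq_div (hmeas 0) hr)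
    hYind hYid).continuous_comp (g := fun x => x / √(pfVar r)) (by fun_prop)
  have hs : √(pfVar r) ≠ 0 := (Real.sqrt_pos.2 hv).ne'
  convert! h using 1
  · funext N ω
    simp only [Function.comp_apply]
    rw [hmean, Real.sqrt_mul (Nat.cast_nonneg N), div_eq_inv_mul, mul_inv]
    ring
  · funext x
    simp only [Function.comp_apply, id]
    field_simp

theorem tendstoInDistribution_pfZGiven [IsProbabilityMeasure P] (hmeas : ∀ j, Measurable (X j))
    (hindep : iIndepFun X P)
    (hunif : ∀ j, pdf.IsUniform (X j) (Metric.closedBall 0 1) P volume) (hr : 0 < r)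
    (hr1 : r ≤ 1) :
    TendstoInDistribution
      (fun (N : ℕ) ω => (pfZGiven X i r N ω - N * pfMean r) / √(N * pfVar r)) atTop
      (id : ℝ → ℝ) (fun _ => P) (gaussianReal 0 1) := by
  have hW : ∀ N : ℕ, AEMeasurable
      (fun ω => (pfZGiven X i r N ω - N * pfMean r) / √(N * pfVar r)) P := fun N =>
    ((aemeasurable_pfZGiven hmeas hunif hr).sub_const _).div_const _
  have hsum := tendstoInDistribution_sum hmeas hindep hunif hr
  -- Slutsky's theorem: the standardized `Z_i` and the standardized sum differ by at most a constant
  -- over `√N`.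
  refine tendstoInDistribution_of_tendstoInMeasure_sub _ _ hsum ?_ hW
  refine tendstoInMeasure_of_tendsto_ae
    (fun N => ((hW N).sub (hsum.forall_aemeasurable N)).aestronglyMeasurable) ?_
  filter_upwards [ae_abs_pfZGiven_sub_le (i := i) hmeas hunif hr hr1] with ω hω
  have hlim : Tendsto (fun N : ℕ => (1 / r ^ 2 + 1) / √(N * pfVar r)) atTop (𝓝 0) :=
    tendsto_const_nhds.div_atTop (Real.tendsto_sqrt_atTop.comp
      (tendsto_natCast_atTop_atTop.atTop_mul_const (pfVar_pos hr)))
  refine squeeze_zero_norm' ?_ hlim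
  filter_upwards [eventually_gt_atTop i] with N hN
  simp only [Pi.sub_apply, Real.norm_eq_abs]
  rw [← sub_div, sub_sub_sub_cancel_right, abs_div, abs_of_nonneg (Real.sqrt_nonneg _)]
  exact div_le_div_of_nonneg_right (hω N hN) (Real.sqrt_nonneg _)

theorem tendsto_kolmogorovDist_pfZGiven [IsProbabilityMeasure P] (hmeas : ∀ j, Measurable (X j))
    (hindep : iIndepFun X P)
    (hunif : ∀ j, pdf.IsUniform (X j) (Metric.closedBall 0 1) P volume) (hr : 0 < r)
    (hr1 : r ≤ 1) :
    Tendsto (fun N : ℕ => kolmogorovDist (P.map (pfZGiven X i r N))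
      (spikedNormal (N * pfMean r) (N * pfVar r).toNNReal)) atTop (𝓝 0) := by
  have hclt := tendstoInDistribution_pfZGiven (i := i) hmeas hindep hunif hr hr1
  set W : ℕ → Ω → ℝ :=
    fun N ω => (pfZGiven X i r N ω - N * pfMean r) / √(N * pfVar r) with hW
  have hWm := hclt.forall_aemeasurable
  have hprob : ∀ N, IsProbabilityMeasure (P.map (W N)) := fun N =>
    Measure.isProbabilityMeasure_map (hWm N)
  have hatom : ∀ x, gaussianReal 0 1 {x} = 0 := fun x => by
    have := nullSingletonClass_gaussianReal (μ := 0) (v := 1) one_ne_zero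
    exact measure_singleton x
  have hlim : ∀ x, Tendsto (fun N => cdf (P.map (W N)) x) atTop
      (𝓝 (cdf (gaussianReal 0 1) x)) := by
    intro x
    simp only [cdf_eq_real, measureReal_def]
    refine (ENNReal.tendsto_toReal (measure_ne_top _ _)).comp ?_
    have h := ProbabilityMeasure.tendsto_measure_of_null_frontier_of_tendsto' hclt.tendsto
      (E := Set.Iic x) (by simp [hatom])
    simpa using h
  have hpolya := fun ε (hε : (0 : ℝ) < ε) => eventually_abs_cdf_sub_le
    (continuous_cdf_of_noAtoms _ hatom) (fun N => monotone_cdf (P.map (W N)))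
    (fun N => cdf_nonneg _) (fun N => cdf_le_one _) hlim hε
  -- The strict form `N > max n₀ i` yields `i < N`, so node `i` belongs to the network.
  rw [Metric.tendsto_atTop']
  intro ε hε
  obtain ⟨n₀, hn₀⟩ := eventually_atTop.1 (hpolya (ε / 2) (by positivity))
  refine ⟨max n₀ i, fun N hN => ?_⟩
  have hiN : i < N := (le_max_right _ _).trans_lt hN
  have hN0 : (0 : ℝ) < N := by exact_mod_cast (Nat.zero_le i).trans_lt hiN
  have hNv : 0 < N * pfVar r := mul_pos hN0 (pfVar_pos hr)
  have hs : 0 < √(N * pfVar r) := Real.sqrt_pos.2 hNv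
  have hZm := aemeasurable_pfZGiven (i := i) (N := N) hmeas hunif hr
  have hbound : ∀ x, |(P.map (pfZGiven X i r N)).real (Set.Iic x) -
      (spikedNormal (N * pfMean r) (N * pfVar r).toNNReal).real (Set.Iic x)| ≤ ε / 2 := by
    intro x
    rcases lt_or_ge x 1 with hx | hx
    · rw [spikedNormal_real_Iic_of_lt _ _ hx, sub_zero,
        map_measureReal_apply_of_aemeasurable hZm measurableSet_Iic]
      have : P.real (pfZGiven X i r N ⁻¹' Set.Iic x) = 0 := by
        rw [measureReal_def, measure_eq_zero_iff_ae_notMem.2, ENNReal.toReal_zero]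
        filter_upwards [ae_one_le_pfZGiven hmeas hunif hr hiN] with ω hω hmem
        exact absurd (hω.trans hmem) (not_le.2 hx)
      rw [this, abs_zero]
      positivity
    · rw [spikedNormal_real_Iic_of_le _ _ hx, gaussianReal_real_Iic hNv,
        map_measureReal_apply_of_aemeasurable hZm measurableSet_Iic]
      have : pfZGiven X i r N ⁻¹' Set.Iic x
          = W N ⁻¹' Set.Iic ((x - N * pfMean r) / √(N * pfVar r)) := by
        ext ω
        simp only [hW, Set.mem_preimage, Set.mem_Iic]
        rw [div_le_div_iff_of_pos_right hs, sub_le_sub_iff_right]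
      rw [this, ← map_measureReal_apply_of_aemeasurable (hWm N) measurableSet_Iic, ← cdf_eq_real]
      exact hn₀ N ((le_max_left _ _).trans hN.le) _
  rw [Real.dist_eq, sub_zero, kolmogorovDist,
    abs_of_nonneg (Real.iSup_nonneg fun _ => abs_nonneg _)]
  exact (ciSup_le hbound).trans_lt (half_lt_self hε)

end Network

end

theorem theorem6 {Ω : Type*} [MeasurableSpace Ω] (P : Measure Ω) [IsProbabilityMeasure P]
    (X : ℕ → Ω → EuclideanSpace ℝ (Fin 2))
    (hmeas : ∀ j, Measurable (X j))
    (hindep : iIndepFun X P)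
    (hunif : ∀ j, pdf.IsUniform (X j) (Metric.closedBall 0 1) P volume)
    (i : ℕ) :
    -- the proportionally fair policy is well defined
    (∀ (N : ℕ) (r : Fin N → ℝ), (∀ j, 0 < r j ∧ r j ≤ 1) → ∃! p, IsPFOptimal 2 1 r p) ∧
    -- the law of `pfZGiven X i r N` is the conditional law of `Z_i` given `R_i = r`
    (∀ N, i < N → AEMeasurable (pfZ X i N) P ∧
      ∀ᵐ r ∂(P.map (fun ω => nodeDist X ω i)),
        condDistrib (pfZ X i N) (fun ω => nodeDist X ω i) P r = P.map (pfZGiven X i r N)) ∧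
    ∀ r : ℝ, 0 < r → r ≤ 1 →
      0 < pfVar r ∧
      -- support in `[1, ∞)`, with an atom at `1`
      (∀ N, i < N →
        (∀ᵐ ω ∂P, 1 ≤ pfZGiven X i r N ω) ∧
        P {ω | pfZGiven X i r N ω = 1} =
          P {ω | ∑ j ∈ (Finset.range N).erase i, nodeDist X ω j ^ 2 ≤ r ^ 2} ∧
        0 < P {ω | pfZGiven X i r N ω = 1}) ∧
      -- the central limit theorem for `Z_i`
      TendstoInDistribution
        (fun (N : ℕ) ω => (pfZGiven X i r N ω - N * pfMean r) / √(N * pfVar r)) atTop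
        (id : ℝ → ℝ) (fun _ => P) (gaussianReal 0 1) ∧
      -- the law of `Z_i` approaches the normal law on `[1, ∞)` with an atom at `1`
      Tendsto
        (fun N : ℕ => kolmogorovDist (P.map (pfZGiven X i r N))
          (spikedNormal (N * pfMean r) (N * pfVar r).toNNReal))
        atTop (𝓝 0) := by
  refine ⟨fun N r hr => existsUnique_isPFOptimal fun j => (hr j).1, fun N hi =>
    ⟨aemeasurable_pfZ hmeas hunif hi, condDistrib_pfZ hmeas hindep hunif hi⟩, fun r hr hr1 =>
    ⟨pfVar_pos hr, fun N hi => ?_, tendstoInDistribution_pfZGiven hmeas hindep hunif hr hr1,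
      tendsto_kolmogorovDist_pfZGiven hmeas hindep hunif hr hr1⟩⟩
  have hmass := measure_pfZGiven_eq_one hmeas hunif hr hi
  refine ⟨ae_one_le_pfZGiven hmeas hunif hr hi, hmass, ?_⟩
  rw [hmass]
  exact measure_sum_nodeDist_sq_le_pos hmeas hindep hunif _ hr
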